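/- Let $n\ge 1$ and $d\ge 2$ be integers. Let $\mathbb{C}\mathbb{H}^{n-1}$ be complex hyperbolic space, realized as the open unit ball of $\mathbb{C}^{n-1}$ (so diffeomorphic to $\mathbb{R}^{2n-2}$), and let $\mathfrak{c}_{n-1}$ be its metric of constant holomorphic sectional curvature $-4$, $$\mathfrak{c}_{n-1}(u,v)=\frac{\operatorname{Re}\langle u,v\rangle}{1-|z|^2}+\frac{\operatorname{Re}\big(\overline{\langle z,u\rangle}\,\langle z,v\rangle\big)}{(1-|z|^2)^2}\qquad(|z|<1),$$ where $\langle\cdot,\cdot\rangle$ is the standard Hermitian inner product. Let $E=\mathbb{C}\mathbb{H}^{n-1}\times\mathbb{S}^1\cong\mathbb{R}^{2n-2}\times\mathbb{S}^1$ with $\mathbb{S}^1=\mathbb{R}/2\pi\mathbb{Z}$, let $\theta$ be the angular coordinate on $\mathbb{S}^1$, and let $r$ be the coordinate on $(0,\infty)$. On $E\times(0,\infty)$ consider the metrics $$g_I=\cosh^2(r)\,\mathfrak{c}_{n-1}+\tfrac14\sinh^2(2r)\,d\theta^2+dr^2,\qquad g_d=\cosh^2(r)\,\mathfrak{c}_{n-1}+\tfrac{d^2}{4}\sinh^2(2r)\,d\theta^2+dr^2,$$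 where $\mathfrak{c}_{n-1}$ is pulled back along the projection $(z,\theta,r)\mapsto z$ (so the horizontal distribution $T\,\mathbb{C}\mathbb{H}^{n-1}$ is integrable and orthogonal to $\partial_\theta$ and $\partial_r$). Then for every $\varepsilon>0$ there exist constants $0<r_2<r_3$ and a smooth Riemannian metric $g$ on the manifold with boundary $E\times[r_2,\infty)$ such that 1. $g=g_I$ at every point of $E\times\{r_2\}$; 2. $g=g_d$ on $E\times(r_3,\infty)$; 3. all sectional curvatures of $g$ lie in the interval $(-4-\varepsilon,\,-1+\varepsilon)$. Moreover, $g$ can be chosen of the form $$g=\cosh^2(r)\,\mathfrak{c}_{n-1}+\tfrac{\sigma(r)^2}{4}\sinh^2(2r)\,d\theta^2+dr^2,$$ where $\sigma:\mathbb{R}\to\mathbb{R}$ is smooth and nondecreasing, with $\sigma(r)=1$ for $r\le r_2$ and $\sigma(r)=d$ for $r\ge r_3$. -/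

import Mathlib

open scoped ContDiff Topology

noncomputable section

namespace WarpedCH

/-! ### Curvature of a metric tensor in coordinates

`G` is a field of bilinear forms on (a subset `Ω` of) a real vector space `V`. All derivatives are
taken within `Ω`, so that the formulas also make sense at boundary points of a domain `Ω` with
boundary. -/

section Curvature

variable {V : Type*} [NormedAddCommGroup V] [NormedSpace ℝ V]

/-- The Christoffel symbols of the first kind, as a covector:
`w ↦ ½ (∂ᵤ G(v, w) + ∂ᵥ G(u, w) - ∂_w G(u, v))`. -/
def christoffelLower (Ω : Set V) (G : V → V →L[ℝ] V →L[ℝ] ℝ) (x u v : V) : V →L[ℝ] ℝ :=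
  (1 / 2 : ℝ) • (fderivWithin ℝ G Ω x u v + fderivWithin ℝ G Ω x v u
    - ((fderivWithin ℝ G Ω x).flip u).flip v)

/-- The Christoffel symbols `Γ(u, v) = ∇ᵤ v` (for constant `u`, `v`) of the Levi-Civita connection:
the vector with `G (Γ(u, v), w) = christoffelLower u v w` for all `w`. -/
def christoffel (Ω : Set V) (G : V → V →L[ℝ] V →L[ℝ] ℝ) (x u v : V) : V :=
  (G x).inverse (christoffelLower Ω G x u v)

/-- The Riemann curvature tensor `R(u, v) w = ∇ᵤ ∇ᵥ w - ∇ᵥ ∇ᵤ w - ∇_[u, v] w` at `x`. -/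
def riemannCurvature (Ω : Set V) (G : V → V →L[ℝ] V →L[ℝ] ℝ) (x u v w : V) : V :=
  fderivWithin ℝ (fun y => christoffel Ω G y v w) Ω x u
    - fderivWithin ℝ (fun y => christoffel Ω G y u w) Ω x v
    + christoffel Ω G x u (christoffel Ω G x v w)
    - christoffel Ω G x v (christoffel Ω G x u w)

/-- The sectional curvature at `x` of the plane spanned by linearly independent `u` and `v`. -/
def sectionalCurvature (Ω : Set V) (G : V → V →L[ℝ] V →L[ℝ] ℝ) (x u v : V) : ℝ :=
  G x (riemannCurvature Ω G x u v v) u / (G x u u * G x v v - (G x u v) ^ 2)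

end Curvature

/-! ### The space `E × [a, ∞)`

`E = ℂℍ^m × 𝕊¹`, where complex hyperbolic space `ℂℍ^m` is the open unit ball of `ℂ^m`
(diffeomorphic to `ℝ^{2m}`) and `𝕊¹ = ℝ / 2πℤ`. -/

/-- Points `(z, θ, r)`; those of `E × [a, ∞)` are the ones with `‖z‖ < 1` and `a ≤ r`. -/
abbrev Point (m : ℕ) : Type := EuclideanSpace ℂ (Fin m) × Real.Angle × ℝ

/-- Tangent vectors `(ζ, τ, ρ)`, meaning `ζ + τ ∂/∂θ + ρ ∂/∂r`. -/
abbrev Tangent (m : ℕ) : Type := EuclideanSpace ℂ (Fin m) × ℝ × ℝ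

/-- Bilinear forms on a tangent space. -/
abbrev Form (m : ℕ) : Type := Tangent m →L[ℝ] Tangent m →L[ℝ] ℝ

/-- `E × [a, ∞)`. -/
def tube (m : ℕ) (a : ℝ) : Set (Point m) := {p | ‖p.1‖ < 1 ∧ a ≤ p.2.2}

/-- The universal cover of `E × [a, ∞)`, where the angle `θ` is a real coordinate. -/
def tubeCover (m : ℕ) (a : ℝ) : Set (Tangent m) := {x | ‖x.1‖ < 1 ∧ a ≤ x.2.2}

/-- The covering map `(z, t, r) ↦ (z, t mod 2π, r)`, a local diffeomorphism whose differential is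
the identity of `Tangent m`. -/
def covering (m : ℕ) (x : Tangent m) : Point m := (x.1, (x.2.1 : Real.Angle), x.2.2)

/-- A smooth Riemannian metric on the manifold with boundary `E × [a, ∞)`; smoothness, up to the
boundary, is tested in the local coordinates given by the covering map. The values of `form`
outside `E × [a, ∞)` carry no information. -/
structure RiemMetric (m : ℕ) (a : ℝ) where
  form : Point m → Form m
  symm : ∀ p ∈ tube m a, ∀ u v, form p u v = form p v u
  pos : ∀ p ∈ tube m a, ∀ u, u ≠ 0 → 0 < form p u u
  smooth : ContDiffOn ℝ ∞ (fun x => form (covering m x)) (tubeCover m a)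

/-- The sectional curvature of a metric on `E × [a, ∞)` at the point `covering m x`,
`x ∈ tubeCover m a`, of the plane spanned by `u` and `v`. -/
def RiemMetric.sectional {m : ℕ} {a : ℝ} (g : RiemMetric m a) (x u v : Tangent m) : ℝ :=
  sectionalCurvature (tubeCover m a) (fun y => g.form (covering m y)) x u v

/-! ### The metrics -/

/-- The metric of complex hyperbolic space `ℂℍ^m` in the ball model, normalized to have constant
holomorphic sectional curvature `-4`:
`(u, v) ↦ Re ⟪u, v⟫ / (1 - |z|²) + Re (conj ⟪z, u⟫ * ⟪z, v⟫) / (1 - |z|²)²`. -/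
def complexHyperbolic (m : ℕ) (z : EuclideanSpace ℂ (Fin m)) :
    EuclideanSpace ℂ (Fin m) →L[ℝ] EuclideanSpace ℂ (Fin m) →L[ℝ] ℝ :=
  (1 - ‖z‖ ^ 2)⁻¹ • (∑ i, (innerSL ℝ (E := ℂ)).bilinearComp
      ((EuclideanSpace.proj (𝕜 := ℂ) i).restrictScalars ℝ)
      ((EuclideanSpace.proj (𝕜 := ℂ) i).restrictScalars ℝ))
    + ((1 - ‖z‖ ^ 2) ^ 2)⁻¹ • (innerSL ℝ (E := ℂ)).bilinearComp
      ((innerSL ℂ z).restrictScalars ℝ) ((innerSL ℂ z).restrictScalars ℝ)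

lemma complexHyperbolic_apply (m : ℕ) (z u v : EuclideanSpace ℂ (Fin m)) :
    complexHyperbolic m z u v = (inner ℂ u v).re / (1 - ‖z‖ ^ 2)
      + ((starRingEnd ℂ) (inner ℂ z u) * inner ℂ z v).re / (1 - ‖z‖ ^ 2) ^ 2 := by
  have h : ∀ a b : ℂ, innerSL ℝ a b = ((starRingEnd ℂ) a * b).re := fun a b => by
    simp [mul_comm]
  simp only [complexHyperbolic, add_apply, smul_apply,
    sum_apply, ContinuousLinearMap.bilinearComp_apply, h,
    ContinuousLinearMap.coe_restrictScalars', innerSL_apply_apply,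
    PiLp.inner_apply, RCLike.inner_apply', smul_eq_mul, div_eq_inv_mul, Complex.re_sum]
  rfl

/-- The metric `h² 𝔠_m + ¼ v² dθ² + dr²` on `E × (0, ∞)`, with vanishing structure constants:
`𝔠_m` is pulled back along the product projection `(z, θ, r) ↦ z`. -/
def warped (m : ℕ) (h v : ℝ → ℝ) (p : Point m) : Form m :=
  (h p.2.2 ^ 2) • (complexHyperbolic m p.1).bilinearComp
      (ContinuousLinearMap.fst ℝ _ _) (ContinuousLinearMap.fst ℝ _ _)
    + (1 / 4 * v p.2.2 ^ 2) • (ContinuousLinearMap.mul ℝ ℝ).bilinearComp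
      (ContinuousLinearMap.fst ℝ _ _ ∘L ContinuousLinearMap.snd ℝ _ _)
      (ContinuousLinearMap.fst ℝ _ _ ∘L ContinuousLinearMap.snd ℝ _ _)
    + (ContinuousLinearMap.mul ℝ ℝ).bilinearComp
      (ContinuousLinearMap.snd ℝ _ _ ∘L ContinuousLinearMap.snd ℝ _ _)
      (ContinuousLinearMap.snd ℝ _ _ ∘L ContinuousLinearMap.snd ℝ _ _)

lemma warped_apply (m : ℕ) (h v : ℝ → ℝ) (p : Point m) (x y : Tangent m) :
    warped m h v p x y = h p.2.2 ^ 2 * complexHyperbolic m p.1 x.1 y.1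
      + 1 / 4 * v p.2.2 ^ 2 * (x.2.1 * y.2.1) + x.2.2 * y.2.2 := by
  simp [warped]

/-- The integrable complex hyperbolic metric `cosh²(r) 𝔠_m + ¼ sinh²(2r) dθ² + dr²`. -/
def gI (m : ℕ) : Point m → Form m :=
  warped m Real.cosh (fun r => Real.sinh (2 * r))

/-- The `d`-fold integrable complex hyperbolic metric
`cosh²(r) 𝔠_m + (d² / 4) sinh²(2r) dθ² + dr²`. -/
def gFold (m d : ℕ) : Point m → Form m :=
  warped m Real.cosh (fun r => d * Real.sinh (2 * r))

end WarpedCH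

end

/-!
The metric has the form `cosh² 𝔠_m + ¼ v² dθ² + dr²` with `v = σ(r) sinh 2r`, where `σ` passes from
`1` to `d` so slowly that `σ'` and `σ''` are uniformly small.

In the orthogonal splitting `T ℂℍ^m ⊕ ∂_θ ⊕ ∂_r` the curvature of `h² 𝔠_m + ¼ v² dθ² + dr²` has no
mixed terms (`warped_riemannCurvature_apply`), so every sectional curvature is a weighted mean of
`(K - h'²) / h²` with `K` a sectional curvature of `𝔠_m`, of `-h'' / h`, of `-h' v' / (h v)` and of
`-v'' / v`. For `h = cosh` and `-4 ≤ K ≤ -1` the first two lie in `[-4, -1]`. For `σ` constant the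
last two are `-(1 + tanh² r)` and `-4`; in general they change by at most a multiple of `σ'` and
`σ''`, because `σ ≥ 1` and `cosh 2r / sinh 2r` is bounded on `r ≥ 1`
(`sectionalCurvature_warped_bounds`).

The curvature is computed from explicit Christoffel symbols, which are recognized by their symmetry
and by the metric being parallel (`christoffel_eq_of_compatible`). In the ball model those of `𝔠_m`
are `Γ(u, v) = α(u) v + α(v) u` with `α = ∂ log (1 - |z|²)⁻¹`; with `H` the Hermitian metric this
gives `R(u, v) w = (H(u, v) - H(v, u)) w + H(u, w) v - H(v, w) u`, whence `-4 ≤ K ≤ -1` by the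
Cauchy–Schwarz inequality for `H` (`complexHyperbolic_curvature`, `chHermitian_sq_le`).
Each directional derivative is taken along a line; since the formulas are smooth across the boundary
`r = r₂`, derivatives within the domain agree with full derivatives there.
-/

noncomputable section

namespace WarpedCH

/-! ### Christoffel symbols from metric compatibility -/

section General

variable {V F : Type*} [NormedAddCommGroup V] [NormedSpace ℝ V]
  [NormedAddCommGroup F] [NormedSpace ℝ F]

lemma fderivWithin_apply_of_hasDerivAt_line {Ω : Set V} {f : V → F} {x u : V} {f' : F}
    (hs : UniqueDiffWithinAt ℝ Ω x) (hf : DifferentiableAt ℝ f x)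
    (h : HasDerivAt (fun t : ℝ => f (x + t • u)) f' 0) : fderivWithin ℝ f Ω x u = f' := by
  rw [fderivWithin_eq_fderiv hs hf]
  exact HasDerivAt.unique (hf.hasFDerivAt.hasLineDerivAt u) h

lemma fderivWithin_apply_apply_apply_of_hasDerivAt_line {Ω : Set V} {G : V → V →L[ℝ] V →L[ℝ] ℝ}
    {x u v w : V} {D : ℝ} (hs : UniqueDiffWithinAt ℝ Ω x) (hG : DifferentiableAt ℝ G x)
    (h : HasDerivAt (fun t : ℝ => G (x + t • u) v w) D 0) : fderivWithin ℝ G Ω x u v w = D := by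
  rw [fderivWithin_eq_fderiv hs hG]
  have h0 : HasLineDerivAt ℝ G (fderiv ℝ G x u) x u := hG.hasFDerivAt.hasLineDerivAt u
  have h1 : HasDerivAt (fun t : ℝ => G (x + t • u)) (fderiv ℝ G x u) 0 := h0
  have h2 := (h1.clm_apply (hasDerivAt_const 0 v)).clm_apply (hasDerivAt_const 0 w)
  simpa using h2.unique h

/-- A nondegenerate form is invertible as a map to the dual space, so that the `inverse` in
`christoffel` is not the junk value `0`. -/
lemma isInvertible_of_pos [FiniteDimensional ℝ V] (B : V →L[ℝ] V →L[ℝ] ℝ)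
    (hB : ∀ u, u ≠ 0 → 0 < B u u) : B.IsInvertible := by
  have hinj : Function.Injective B := by
    rw [injective_iff_map_eq_zero]
    intro u hu
    by_contra h
    have := hB u h
    simp [hu] at this
  have hfin : Module.finrank ℝ V = Module.finrank ℝ (V →L[ℝ] ℝ) := by
    rw [← (LinearMap.toContinuousLinearMap (𝕜 := ℝ) (E := V) (F' := ℝ)).finrank_eq]
    exact (Subspace.dual_finrank_eq (K := ℝ) (V := V)).symm
  let e := LinearMap.linearEquivOfInjective (B : V →ₗ[ℝ] V →L[ℝ] ℝ) hinj hfin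
  refine ⟨e.toContinuousLinearEquiv, ?_⟩
  ext u v
  rfl

/-- Uniqueness of the Levi-Civita connection: a symmetric `Γ` with respect to which the metric is
parallel is the Christoffel symbol. -/
lemma christoffel_eq_of_compatible [FiniteDimensional ℝ V] {Ω : Set V}
    {G : V → V →L[ℝ] V →L[ℝ] ℝ} {x : V} (Γ : V → V → V)
    (hpos : ∀ u, u ≠ 0 → 0 < G x u u) (hsymm : ∀ u v, G x u v = G x v u)
    (hΓ : ∀ u v, Γ u v = Γ v u)
    (hG : ∀ u v w, fderivWithin ℝ G Ω x u v w = G x (Γ u v) w + G x v (Γ u w)) (u v : V) :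
    christoffel Ω G x u v = Γ u v := by
  have : christoffelLower Ω G x u v = G x (Γ u v) := by
    ext w
    simp only [christoffelLower, smul_apply, sub_apply, add_apply,
      ContinuousLinearMap.flip_apply, hG, smul_eq_mul, hsymm v, hsymm u, hΓ v u, hΓ w, hsymm (Γ u v)]
    ring
  rw [christoffel, this, (isInvertible_of_pos _ hpos).inverse_apply_self]

/-- The strict Cauchy–Schwarz inequality for a positive definite symmetric bilinear form. -/
lemma gram_pos (B : V →L[ℝ] V →L[ℝ] ℝ) (hpos : ∀ u, u ≠ 0 → 0 < B u u)
    (hsymm : ∀ u v, B u v = B v u) {u v : V} (h : LinearIndependent ℝ ![u, v]) :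
    0 < B u u * B v v - B u v ^ 2 := by
  rw [LinearIndependent.pair_iff] at h
  have hv : v ≠ 0 := by
    rintro rfl
    simpa using h 0 1 (by simp)
  have hvv := hpos v hv
  have hy : B v v • u + (-B u v) • v ≠ 0 := fun h0 => hvv.ne' (h _ _ h0).1
  have := hpos _ hy
  simp only [map_add, map_smul, add_apply, smul_apply, smul_eq_mul, hsymm v u] at this
  have h2 : 0 < B v v * (B u u * B v v - B u v ^ 2) := by nlinarith
  exact pos_of_mul_pos_right h2 hvv.le

end General

/-! ### The curvature of complex hyperbolic space -/

section ComplexHyperbolic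

variable {m : ℕ}

/-- The `(1, 0)`-form `∂ log (1 - |z|²)⁻¹`, that is `u ↦ ⟪z, u⟫ / (1 - |z|²)`. -/
def chPotential (z u : EuclideanSpace ℂ (Fin m)) : ℂ := inner ℂ z u / ((1 - ‖z‖ ^ 2 : ℝ) : ℂ)

/-- The Hermitian metric of complex hyperbolic space, conjugate linear in the first variable; its
real part is `complexHyperbolic`. -/
def chHermitian (z u v : EuclideanSpace ℂ (Fin m)) : ℂ :=
  inner ℂ u v / ((1 - ‖z‖ ^ 2 : ℝ) : ℂ) + (starRingEnd ℂ) (chPotential z u) * chPotential z v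

/-- The Christoffel symbols of complex hyperbolic space in the ball model. -/
def chChristoffel (z u v : EuclideanSpace ℂ (Fin m)) : EuclideanSpace ℂ (Fin m) :=
  chPotential z u • v + chPotential z v • u

lemma complexHyperbolic_eq_re (z u v : EuclideanSpace ℂ (Fin m)) :
    complexHyperbolic m z u v = (chHermitian z u v).re := by
  rw [complexHyperbolic_apply, chHermitian, chPotential, chPotential, map_div₀, Complex.conj_ofReal,
    div_mul_div_comm, ← Complex.ofReal_mul, Complex.add_re, Complex.div_ofReal_re,
    Complex.div_ofReal_re, sq (1 - ‖z‖ ^ 2)]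

section Algebra
variable (z u v w : EuclideanSpace ℂ (Fin m)) (c : ℂ) (k : ℝ)

lemma chPotential_add : chPotential z (u + v) = chPotential z u + chPotential z v := by
  simp [chPotential, add_div]

lemma chPotential_smul : chPotential z (c • u) = c * chPotential z u := by
  simp [chPotential, mul_div_assoc]

lemma chHermitian_add_right :
    chHermitian z u (v + w) = chHermitian z u v + chHermitian z u w := by
  simp only [chHermitian, inner_add_right, chPotential_add]; ring

lemma chHermitian_smul_right : chHermitian z u (c • v) = c * chHermitian z u v := by
  simp only [chHermitian, inner_smul_right, chPotential_smul]; ring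

lemma chHermitian_conj : (starRingEnd ℂ) (chHermitian z u v) = chHermitian z v u := by
  simp only [chHermitian, map_add, map_div₀, map_mul, inner_conj_symm, Complex.conj_conj,
    Complex.conj_ofReal]
  ring

lemma chHermitian_add_left :
    chHermitian z (u + v) w = chHermitian z u w + chHermitian z v w := by
  rw [← chHermitian_conj, chHermitian_add_right, map_add, chHermitian_conj, chHermitian_conj]

lemma chHermitian_smul_left :
    chHermitian z (c • u) v = (starRingEnd ℂ) c * chHermitian z u v := by
  rw [← chHermitian_conj, chHermitian_smul_right, map_mul, chHermitian_conj]

lemma chHermitian_self : chHermitian z u u = (complexHyperbolic m z u u : ℂ) := by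
  rw [complexHyperbolic_eq_re]
  exact (Complex.conj_eq_iff_re.1 (chHermitian_conj z u u)).symm

lemma complexHyperbolic_symm : complexHyperbolic m z u v = complexHyperbolic m z v u := by
  rw [complexHyperbolic_eq_re, complexHyperbolic_eq_re, ← chHermitian_conj, Complex.conj_re]

lemma chChristoffel_symm : chChristoffel z u v = chChristoffel z v u := add_comm _ _

lemma chChristoffel_add_right :
    chChristoffel z u (v + w) = chChristoffel z u v + chChristoffel z u w := by
  simp only [chChristoffel, chPotential_add]; module

lemma chChristoffel_smul_right : chChristoffel z u (k • v) = k • chChristoffel z u v := by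
  have h : k • v = (k : ℂ) • v := (Complex.coe_smul k v).symm
  rw [h, ← Complex.coe_smul k (chChristoffel z u v)]
  simp only [chChristoffel, chPotential_smul]; module

end Algebra

lemma complexHyperbolic_self_pos {z u : EuclideanSpace ℂ (Fin m)} (hz : ‖z‖ < 1) (hu : u ≠ 0) :
    0 < complexHyperbolic m z u u := by
  have hS : 0 < 1 - ‖z‖ ^ 2 := by nlinarith [norm_nonneg z]
  have h1 : 0 < ‖u‖ ^ 2 := by positivity
  have h2 : (inner ℂ u u).re = ‖u‖ ^ 2 := inner_self_eq_norm_sq (𝕜 := ℂ) u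
  rw [complexHyperbolic_apply, h2, mul_comm, Complex.mul_conj, Complex.ofReal_re]
  have := Complex.normSq_nonneg (inner ℂ z u)
  positivity

lemma complexHyperbolic_self_nonneg {z : EuclideanSpace ℂ (Fin m)} (hz : ‖z‖ < 1)
    (u : EuclideanSpace ℂ (Fin m)) : 0 ≤ complexHyperbolic m z u u := by
  rcases eq_or_ne u 0 with rfl | hu
  · simp
  · exact (complexHyperbolic_self_pos hz hu).le

/-- The Cauchy–Schwarz inequality for the Hermitian metric. -/
lemma chHermitian_sq_le {z : EuclideanSpace ℂ (Fin m)} (hz : ‖z‖ < 1)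
    (u v : EuclideanSpace ℂ (Fin m)) :
    (chHermitian z u v).re ^ 2 + (chHermitian z u v).im ^ 2
      ≤ complexHyperbolic m z u u * complexHyperbolic m z v v := by
  rcases eq_or_ne v 0 with rfl | hv
  · have : chHermitian z u 0 = 0 := by simpa using chHermitian_smul_right z u 0 0
    simp [this]
  have hvv := complexHyperbolic_self_pos hz hv
  have := complexHyperbolic_self_nonneg hz
    ((complexHyperbolic m z v v : ℂ) • u + (-chHermitian z v u) • v)
  rw [complexHyperbolic_eq_re z (_ + _)] at this
  simp only [chHermitian_add_right, chHermitian_add_left, chHermitian_smul_right,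
    chHermitian_smul_left] at this
  simp only [chHermitian_self, ← chHermitian_conj z u v, Complex.add_re, Complex.add_im,
    Complex.mul_re, Complex.mul_im, Complex.neg_re, Complex.neg_im, Complex.conj_re,
    Complex.conj_im, Complex.ofReal_re, Complex.ofReal_im, map_neg] at this
  have h2 : 0 ≤ complexHyperbolic m z v v * (complexHyperbolic m z u u * complexHyperbolic m z v v
      - ((chHermitian z u v).re ^ 2 + (chHermitian z u v).im ^ 2)) := by
    nlinarith
  linarith [nonneg_of_mul_nonneg_right h2 hvv]

section Derivatives

variable {z : EuclideanSpace ℂ (Fin m)} (a u v w : EuclideanSpace ℂ (Fin m))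

lemma one_sub_norm_sq_ofReal_ne_zero (hz : ‖z‖ < 1) : ((1 - ‖z‖ ^ 2 : ℝ) : ℂ) ≠ 0 := by
  have : 0 < 1 - ‖z‖ ^ 2 := by nlinarith [norm_nonneg z]
  exact_mod_cast this.ne'

lemma hasDerivAt_line : HasDerivAt (fun t : ℝ => z + t • a) a 0 := by
  simpa using ((hasDerivAt_id (0 : ℝ)).smul_const a).const_add z

lemma hasDerivAt_one_sub_norm_sq : HasDerivAt (fun t : ℝ => ((1 - ‖z + t • a‖ ^ 2 : ℝ) : ℂ))
    (-(inner ℂ z a + (starRingEnd ℂ) (inner ℂ z a))) 0 := by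
  have h := ((hasDerivAt_line (z := z) a).inner ℂ (hasDerivAt_line (z := z) a)).const_sub 1
  have e : (fun t : ℝ => ((1 - ‖z + t • a‖ ^ 2 : ℝ) : ℂ))
      = fun t : ℝ => 1 - inner ℂ (z + t • a) (z + t • a) := by
    funext t
    rw [inner_self_eq_norm_sq_to_K]
    push_cast
    rfl
  rw [e]
  simpa [inner_conj_symm] using h

lemma hasDerivAt_chPotential (hz : ‖z‖ < 1) :
    HasDerivAt (fun t : ℝ => chPotential (z + t • a) v)
      (chHermitian z a v + chPotential z a * chPotential z v) 0 := by
  have hS := one_sub_norm_sq_ofReal_ne_zero hz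
  have h := ((hasDerivAt_line (z := z) a).inner ℂ (hasDerivAt_const (0 : ℝ) v)).div
    (hasDerivAt_one_sub_norm_sq (z := z) a) (by simpa using hS)
  refine h.congr_deriv ?_
  simp only [zero_smul, add_zero, inner_zero_right, zero_add, chHermitian, chPotential,
    map_div₀, Complex.conj_ofReal]
  field_simp
  ring

lemma hasDerivAt_chHermitian (hz : ‖z‖ < 1) :
    HasDerivAt (fun t : ℝ => chHermitian (z + t • a) u v)
      (chHermitian z (chChristoffel z a u) v + chHermitian z u (chChristoffel z a v)) 0 := by
  have hS := one_sub_norm_sq_ofReal_ne_zero hz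
  have h1 := (hasDerivAt_const (0 : ℝ) (inner ℂ u v)).div
    (hasDerivAt_one_sub_norm_sq (z := z) a) (by simpa using hS)
  have h2 := (hasDerivAt_chPotential a u hz).star.mul (hasDerivAt_chPotential a v hz)
  refine (h1.add h2).congr_deriv ?_
  simp only [chChristoffel, chHermitian_add_left, chHermitian_add_right, chHermitian_smul_left,
    chHermitian_smul_right]
  simp only [zero_smul, add_zero, chHermitian, chPotential, map_div₀, Complex.conj_ofReal, map_add,
    map_mul, inner_conj_symm, Complex.star_def, zero_mul, zero_sub]
  field_simp
  ring

lemma hasDerivAt_complexHyperbolic (hz : ‖z‖ < 1) :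
    HasDerivAt (fun t : ℝ => complexHyperbolic m (z + t • a) u v)
      (complexHyperbolic m z (chChristoffel z a u) v
        + complexHyperbolic m z u (chChristoffel z a v)) 0 := by
  simp only [complexHyperbolic_eq_re, ← Complex.add_re]
  exact Complex.reCLM.hasFDerivAt.comp_hasDerivAt _ (hasDerivAt_chHermitian a u v hz)

/-- The derivative of `chChristoffel z v w` in the direction `a`. -/
def chChristoffelDeriv (z a v w : EuclideanSpace ℂ (Fin m)) : EuclideanSpace ℂ (Fin m) :=
  (chHermitian z a v + chPotential z a * chPotential z v) • w
    + (chHermitian z a w + chPotential z a * chPotential z w) • v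

lemma hasDerivAt_chChristoffel (hz : ‖z‖ < 1) :
    HasDerivAt (fun t : ℝ => chChristoffel (z + t • a) v w) (chChristoffelDeriv z a v w) 0 :=
  ((hasDerivAt_chPotential a v hz).smul_const w).add ((hasDerivAt_chPotential a w hz).smul_const v)

/-- The curvature of complex hyperbolic space: `R(u, v) v`, paired with `u`. Its value shows that
the holomorphic sectional curvature is `-4`. -/
lemma complexHyperbolic_curvature :
    complexHyperbolic m z (chChristoffelDeriv z u v v - chChristoffelDeriv z v u v
        + chChristoffel z u (chChristoffel z v v) - chChristoffel z v (chChristoffel z u v)) u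
      = -(complexHyperbolic m z u u * complexHyperbolic m z v v - (complexHyperbolic m z u v) ^ 2
        + 3 * (chHermitian z u v).im ^ 2) := by
  have e : chChristoffelDeriv z u v v - chChristoffelDeriv z v u v
        + chChristoffel z u (chChristoffel z v v) - chChristoffel z v (chChristoffel z u v)
      = (2 * chHermitian z u v - chHermitian z v u) • v + (-chHermitian z v v) • u := by
    simp only [chChristoffelDeriv, chChristoffel, chPotential_add, chPotential_smul]
    module
  rw [e, complexHyperbolic_symm, complexHyperbolic_eq_re]
  simp only [chHermitian_add_right, chHermitian_smul_right, chHermitian_self,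
    complexHyperbolic_eq_re z u v, ← chHermitian_conj z u v]
  simp only [Complex.add_re, Complex.sub_re, Complex.sub_im, Complex.mul_re, Complex.mul_im,
    Complex.neg_re, Complex.neg_im, Complex.conj_re, Complex.conj_im, Complex.ofReal_re,
    Complex.ofReal_im, Complex.re_ofNat, Complex.im_ofNat]
  ring

end Derivatives

end ComplexHyperbolic

/-! ### Smoothness -/

section Smoothness

variable {m : ℕ}

lemma contDiffAt_chPotential {z : EuclideanSpace ℂ (Fin m)} (hz : ‖z‖ < 1)
    (v : EuclideanSpace ℂ (Fin m)) : ContDiffAt ℝ ∞ (fun y => chPotential y v) z := by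
  have h1 : ContDiffAt ℝ ∞ (fun y : EuclideanSpace ℂ (Fin m) => ((1 - ‖y‖ ^ 2 : ℝ) : ℂ)) z :=
    Complex.ofRealCLM.contDiff.contDiffAt.comp z
      (contDiffAt_const.sub (contDiff_norm_sq ℂ).contDiffAt)
  simp only [chPotential, div_eq_mul_inv]
  exact (contDiffAt_id.inner ℂ contDiffAt_const).mul (h1.inv (one_sub_norm_sq_ofReal_ne_zero hz))

lemma contDiffAt_chHermitian {z : EuclideanSpace ℂ (Fin m)} (hz : ‖z‖ < 1)
    (u v : EuclideanSpace ℂ (Fin m)) : ContDiffAt ℝ ∞ (fun y => chHermitian y u v) z := by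
  have h1 : ContDiffAt ℝ ∞ (fun y : EuclideanSpace ℂ (Fin m) => ((1 - ‖y‖ ^ 2 : ℝ) : ℂ)) z :=
    Complex.ofRealCLM.contDiff.contDiffAt.comp z
      (contDiffAt_const.sub (contDiff_norm_sq ℂ).contDiffAt)
  simp only [chHermitian, div_eq_mul_inv]
  exact (contDiffAt_const.mul (h1.inv (one_sub_norm_sq_ofReal_ne_zero hz))).add
    ((Complex.conjCLE.contDiff.contDiffAt.comp z (contDiffAt_chPotential hz u)).mul
      (contDiffAt_chPotential hz v))

lemma contDiffAt_complexHyperbolic {z : EuclideanSpace ℂ (Fin m)} (hz : ‖z‖ < 1)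
    (u v : EuclideanSpace ℂ (Fin m)) :
    ContDiffAt ℝ ∞ (fun y => complexHyperbolic m y u v) z := by
  simp only [complexHyperbolic_eq_re]
  exact Complex.reCLM.contDiff.contDiffAt.comp z (contDiffAt_chHermitian hz u v)

lemma contDiffAt_chChristoffel {z : EuclideanSpace ℂ (Fin m)} (hz : ‖z‖ < 1)
    (u v : EuclideanSpace ℂ (Fin m)) : ContDiffAt ℝ ∞ (fun y => chChristoffel y u v) z :=
  ((contDiffAt_chPotential hz u).smul contDiffAt_const).add
    ((contDiffAt_chPotential hz v).smul contDiffAt_const)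

lemma contDiffOn_warped {h v : ℝ → ℝ} (hh : ContDiff ℝ ∞ h) (hv : ContDiff ℝ ∞ v) :
    ContDiffOn ℝ ∞ (fun x => warped m h v (covering m x)) {x | ‖x.1‖ < 1} := by
  rw [contDiffOn_clm_apply]
  intro a
  rw [contDiffOn_clm_apply]
  intro b x hx
  refine ContDiffAt.contDiffWithinAt ?_
  simp only [warped_apply, covering]
  have hC : ContDiffAt ℝ ∞ (fun y : Tangent m => complexHyperbolic m y.1 a.1 b.1) x :=
    (contDiffAt_complexHyperbolic (z := x.1) hx a.1 b.1).comp x contDiffAt_fst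
  have hr : ContDiffAt ℝ ∞ (fun y : Tangent m => y.2.2) x := by fun_prop
  have h1 := hh.contDiffAt.comp x hr
  have h2 := hv.contDiffAt.comp x hr
  exact (((h1.pow 2).mul hC).add ((contDiffAt_const.mul (h2.pow 2)).mul contDiffAt_const)).add
    contDiffAt_const

lemma differentiableAt_warped {h v : ℝ → ℝ} (hh : ContDiff ℝ ∞ h) (hv : ContDiff ℝ ∞ v)
    {x : Tangent m} (hx : ‖x.1‖ < 1) :
    DifferentiableAt ℝ (fun x => warped m h v (covering m x)) x := by
  have ho : IsOpen {x : Tangent m | ‖x.1‖ < 1} :=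
    isOpen_lt (by fun_prop) continuous_const
  exact ((contDiffOn_warped hh hv).contDiffAt (ho.mem_nhds hx)).differentiableAt (by simp)

end Smoothness

/-! ### The Christoffel symbols of the warped product -/

section Christoffel

variable {m : ℕ}

/-- The Christoffel symbols of the metric `h² 𝔠_m + ¼ v² dθ² + dr²` in the coordinates
`(z, θ, r)`. -/
def warpedChristoffel (h v : ℝ → ℝ) (x a b : Tangent m) : Tangent m :=
  (chChristoffel x.1 a.1 b.1 + (deriv h x.2.2 / h x.2.2) • (a.2.2 • b.1 + b.2.2 • a.1),
    deriv v x.2.2 / v x.2.2 * (a.2.2 * b.2.1 + b.2.2 * a.2.1),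
    -(h x.2.2 * deriv h x.2.2) * complexHyperbolic m x.1 a.1 b.1
      - 1 / 4 * (v x.2.2 * deriv v x.2.2) * (a.2.1 * b.2.1))

lemma warpedChristoffel_symm (h v : ℝ → ℝ) (x a b : Tangent m) :
    warpedChristoffel h v x a b = warpedChristoffel h v x b a := by
  simp only [warpedChristoffel, chChristoffel_symm x.1 b.1, complexHyperbolic_symm x.1 b.1,
    add_comm (b.2.2 • a.1), add_comm (b.2.2 * a.2.1), mul_comm b.2.1]

lemma warped_symm (h v : ℝ → ℝ) (p : Point m) (a b : Tangent m) :
    warped m h v p a b = warped m h v p b a := by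
  simp only [warped_apply, complexHyperbolic_symm p.1 b.1, mul_comm b.2.1, mul_comm b.2.2]

lemma warped_pos {h v : ℝ → ℝ} {p : Point m} (hp : ‖p.1‖ < 1) (hh : h p.2.2 ≠ 0)
    (hv : v p.2.2 ≠ 0) {a : Tangent m} (ha : a ≠ 0) : 0 < warped m h v p a a := by
  have h1 : 0 < h p.2.2 ^ 2 := by positivity
  have h2 : 0 < v p.2.2 ^ 2 := by positivity
  have h3 := complexHyperbolic_self_nonneg hp a.1
  rw [warped_apply]
  rcases eq_or_ne a.1 0 with h0 | h0
  · rcases eq_or_ne a.2.1 0 with h4 | h4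
    · have h5 : a.2.2 ≠ 0 := fun h5 => ha (Prod.ext h0 (Prod.ext h4 h5))
      have : 0 < a.2.2 * a.2.2 := mul_self_pos.2 h5
      have := mul_self_nonneg a.2.1
      positivity
    · have : 0 < a.2.1 * a.2.1 := mul_self_pos.2 h4
      have := mul_self_nonneg a.2.2
      positivity
  · have := complexHyperbolic_self_pos hp h0
    have := mul_self_nonneg a.2.1
    have := mul_self_nonneg a.2.2
    positivity

lemma convex_tubeCover (m : ℕ) (a : ℝ) : Convex ℝ (tubeCover m a) := by
  have h1 : Convex ℝ {z : EuclideanSpace ℂ (Fin m) | ‖z‖ < 1} := by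
    simpa [Metric.ball, dist_zero_right] using
      convex_ball (E := EuclideanSpace ℂ (Fin m)) 0 1
  exact (h1.linear_preimage (LinearMap.fst ℝ (EuclideanSpace ℂ (Fin m)) (ℝ × ℝ))).inter
    ((convex_Ici a).linear_preimage
      (LinearMap.snd ℝ ℝ ℝ ∘ₗ LinearMap.snd ℝ (EuclideanSpace ℂ (Fin m)) (ℝ × ℝ)))

lemma uniqueDiffOn_tubeCover (m : ℕ) (a : ℝ) : UniqueDiffOn ℝ (tubeCover m a) := by
  refine uniqueDiffOn_convex (convex_tubeCover m a) ⟨(0, 0, a + 1), ?_⟩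
  have h1 : IsOpen {x : Tangent m | ‖x.1‖ < 1} := isOpen_lt (by fun_prop) continuous_const
  have h2 : IsOpen {x : Tangent m | a < x.2.2} := isOpen_lt continuous_const (by fun_prop)
  have ho : IsOpen {x : Tangent m | ‖x.1‖ < 1 ∧ a < x.2.2} := h1.inter h2
  exact mem_interior.2 ⟨_, fun x hx => ⟨hx.1, hx.2.le⟩, ho, by simp⟩

lemma hasDerivAt_comp_line {f : ℝ → ℝ} (hf : Differentiable ℝ f) (r ρ : ℝ) :
    HasDerivAt (fun t : ℝ => f (r + t * ρ)) (deriv f r * ρ) 0 := by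
  have h1 : HasDerivAt (fun t : ℝ => r + t * ρ) ρ 0 := by
    simpa using ((hasDerivAt_id (0 : ℝ)).mul_const ρ).const_add r
  have h2 : HasDerivAt f (deriv f r) (r + 0 * ρ) := by simpa using (hf r).hasDerivAt
  exact h2.comp 0 h1

variable {h v : ℝ → ℝ} {r₀ : ℝ}

lemma christoffel_warped (hh : ContDiff ℝ ∞ h) (hv : ContDiff ℝ ∞ v) {x : Tangent m}
    (hx : x ∈ tubeCover m r₀) (hh0 : h x.2.2 ≠ 0) (hv0 : v x.2.2 ≠ 0) (a b : Tangent m) :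
    christoffel (tubeCover m r₀) (fun y => warped m h v (covering m y)) x a b
      = warpedChristoffel h v x a b := by
  refine christoffel_eq_of_compatible (warpedChristoffel h v x)
    (fun u hu => warped_pos (p := covering m x) hx.1 hh0 hv0 hu)
    (warped_symm h v (covering m x)) (warpedChristoffel_symm h v x)
    (fun u b c => ?_) a b
  refine fderivWithin_apply_apply_apply_of_hasDerivAt_line (uniqueDiffOn_tubeCover m r₀ x hx)
    (differentiableAt_warped hh hv hx.1) ?_
  simp only [warped_apply, covering, Prod.fst_add, Prod.smul_fst, Prod.snd_add, Prod.smul_snd,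
    smul_eq_mul]
  have h1 := hasDerivAt_comp_line (hh.differentiable (by simp)) x.2.2 u.2.2
  have h2 := hasDerivAt_comp_line (hv.differentiable (by simp)) x.2.2 u.2.2
  have h3 := hasDerivAt_complexHyperbolic u.1 b.1 c.1 hx.1
  refine ((((h1.pow 2).mul h3).add (((h2.pow 2).const_mul (1 / 4)).mul_const
    (b.2.1 * c.2.1))).add (hasDerivAt_const 0 (b.2.2 * c.2.2))).congr_deriv ?_
  simp only [warpedChristoffel, zero_smul, add_zero, zero_mul, map_add, map_smul, add_apply,
    smul_apply, smul_eq_mul, complexHyperbolic_symm x.1 b.1 u.1]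
  simp
  field_simp
  ring

end Christoffel

/-! ### The curvature of the warped product -/

section WarpedCurvature

variable {m : ℕ} {h v : ℝ → ℝ} {r₀ : ℝ}

/-- The derivative of `warpedChristoffel h v x b c` in the direction `a`. -/
def warpedChristoffelDeriv (h v : ℝ → ℝ) (x a b c : Tangent m) : Tangent m :=
  (chChristoffelDeriv x.1 a.1 b.1 c.1
      + ((deriv (deriv h) x.2.2 / h x.2.2 - (deriv h x.2.2 / h x.2.2) ^ 2) * a.2.2) •
        (b.2.2 • c.1 + c.2.2 • b.1),
    (deriv (deriv v) x.2.2 / v x.2.2 - (deriv v x.2.2 / v x.2.2) ^ 2) * a.2.2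
      * (b.2.2 * c.2.1 + c.2.2 * b.2.1),
    -((deriv h x.2.2 ^ 2 + h x.2.2 * deriv (deriv h) x.2.2) * a.2.2)
        * complexHyperbolic m x.1 b.1 c.1
      - h x.2.2 * deriv h x.2.2 * (complexHyperbolic m x.1 (chChristoffel x.1 a.1 b.1) c.1
        + complexHyperbolic m x.1 b.1 (chChristoffel x.1 a.1 c.1))
      - 1 / 4 * ((deriv v x.2.2 ^ 2 + v x.2.2 * deriv (deriv v) x.2.2) * a.2.2)
        * (b.2.1 * c.2.1))

lemma hasDerivAt_warpedChristoffel (hh : ContDiff ℝ ∞ h) (hv : ContDiff ℝ ∞ v) {x : Tangent m}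
    (hx : ‖x.1‖ < 1) (hh0 : h x.2.2 ≠ 0) (hv0 : v x.2.2 ≠ 0) (a b c : Tangent m) :
    HasDerivAt (fun t : ℝ => warpedChristoffel h v (x + t • a) b c)
      (warpedChristoffelDeriv h v x a b c) 0 := by
  have h1 := hasDerivAt_comp_line (hh.differentiable (by simp)) x.2.2 a.2.2
  have h2 := hasDerivAt_comp_line
    ((contDiff_infty_iff_deriv.1 hh).2.differentiable (by simp)) x.2.2 a.2.2
  have h3 := hasDerivAt_comp_line (hv.differentiable (by simp)) x.2.2 a.2.2
  have h4 := hasDerivAt_comp_line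
    ((contDiff_infty_iff_deriv.1 hv).2.differentiable (by simp)) x.2.2 a.2.2
  have h5 := hasDerivAt_complexHyperbolic a.1 b.1 c.1 hx
  have h6 := hasDerivAt_chChristoffel a.1 b.1 c.1 hx
  refine HasDerivAt.prodMk ?_ (HasDerivAt.prodMk ?_ ?_)
  · refine (h6.add ((h2.div h1 (by simpa using hh0)).smul_const
      (b.2.2 • c.1 + c.2.2 • b.1))).congr_deriv ?_
    congr 2
    simp only [zero_mul, add_zero]
    field_simp
  · refine ((h4.div h3 (by simpa using hv0)).mul_const
      (b.2.2 * c.2.1 + c.2.2 * b.2.1)).congr_deriv ?_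
    congr 1
    simp only [zero_mul, add_zero]
    field_simp
  · refine (((h1.mul h2).neg.mul h5).sub (((h3.mul h4).const_mul (1 / 4)).mul_const
      (b.2.1 * c.2.1))).congr_deriv ?_
    simp only [zero_mul, add_zero, zero_smul, Pi.mul_apply, Pi.neg_apply]
    ring

lemma differentiableAt_warpedChristoffel (hh : ContDiff ℝ ∞ h) (hv : ContDiff ℝ ∞ v)
    {x : Tangent m} (hx : ‖x.1‖ < 1) (hh0 : h x.2.2 ≠ 0) (hv0 : v x.2.2 ≠ 0) (b c : Tangent m) :
    DifferentiableAt ℝ (fun y => warpedChristoffel h v y b c) x := by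
  have hr : ContDiffAt ℝ ∞ (fun y : Tangent m => y.2.2) x := by fun_prop
  have h1 := hh.contDiffAt.comp x hr
  have h2 := (contDiff_infty_iff_deriv.1 hh).2.contDiffAt.comp x hr
  have h3 := hv.contDiffAt.comp x hr
  have h4 := (contDiff_infty_iff_deriv.1 hv).2.contDiffAt.comp x hr
  have h5 : ContDiffAt ℝ ∞ (fun y : Tangent m => complexHyperbolic m y.1 b.1 c.1) x :=
    (contDiffAt_complexHyperbolic (z := x.1) hx b.1 c.1).comp x contDiffAt_fst
  have h6 : ContDiffAt ℝ ∞ (fun y : Tangent m => chChristoffel y.1 b.1 c.1) x :=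
    (contDiffAt_chChristoffel (z := x.1) hx b.1 c.1).comp x contDiffAt_fst
  refine ContDiffAt.differentiableAt (n := ∞) ?_ (by simp)
  exact (h6.add ((h2.div h1 hh0).smul contDiffAt_const)).prodMk
    (((h4.div h3 hv0).mul contDiffAt_const).prodMk
      (((h1.mul h2).neg.mul h5).sub ((contDiffAt_const.mul (h3.mul h4)).mul contDiffAt_const)))

lemma riemannCurvature_warped (hh : ContDiff ℝ ∞ h) (hv : ContDiff ℝ ∞ v)
    (hh0 : ∀ r, r₀ ≤ r → h r ≠ 0) (hv0 : ∀ r, r₀ ≤ r → v r ≠ 0) {x : Tangent m}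
    (hx : x ∈ tubeCover m r₀) (a b c : Tangent m) :
    riemannCurvature (tubeCover m r₀) (fun y => warped m h v (covering m y)) x a b c
      = warpedChristoffelDeriv h v x a b c - warpedChristoffelDeriv h v x b a c
        + warpedChristoffel h v x a (warpedChristoffel h v x b c)
        - warpedChristoffel h v x b (warpedChristoffel h v x a c) := by
  have key : ∀ b c, Set.EqOn
      (fun y => christoffel (tubeCover m r₀) (fun y => warped m h v (covering m y)) y b c)
      (fun y => warpedChristoffel h v y b c) (tubeCover m r₀) := fun b c y hy =>
    christoffel_warped hh hv hy (hh0 _ hy.2) (hv0 _ hy.2) b c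
  have hder : ∀ a b c, fderivWithin ℝ
      (fun y => christoffel (tubeCover m r₀) (fun y => warped m h v (covering m y)) y b c)
      (tubeCover m r₀) x a = warpedChristoffelDeriv h v x a b c := fun a b c => by
    rw [fderivWithin_congr (key b c) (key b c hx)]
    exact fderivWithin_apply_of_hasDerivAt_line (uniqueDiffOn_tubeCover m r₀ x hx)
      (differentiableAt_warpedChristoffel hh hv hx.1 (hh0 _ hx.2) (hv0 _ hx.2) b c)
      (hasDerivAt_warpedChristoffel hh hv hx.1 (hh0 _ hx.2) (hv0 _ hx.2) a b c)
  have hchr : ∀ b c, christoffel (tubeCover m r₀) (fun y => warped m h v (covering m y)) x b c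
      = warpedChristoffel h v x b c := fun b c => key b c hx
  simp only [riemannCurvature, hder, hchr]

/-- The Gauss-type decomposition of the curvature of `h² 𝔠_m + ¼ v² dθ² + dr²`: the sectional
curvatures of coordinate planes are those of `𝔠_m` minus `h'²`, over `h²`, together with
`-h'' / h`, `-h' v' / (h v)` and `-v'' / v`, and there are no mixed terms. -/
lemma warped_riemannCurvature_apply (hh : ContDiff ℝ ∞ h) (hv : ContDiff ℝ ∞ v)
    (hh0 : ∀ r, r₀ ≤ r → h r ≠ 0) (hv0 : ∀ r, r₀ ≤ r → v r ≠ 0) {x : Tangent m}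
    (hx : x ∈ tubeCover m r₀) (a b : Tangent m) :
    warped m h v (covering m x)
      (riemannCurvature (tubeCover m r₀) (fun y => warped m h v (covering m y)) x a b b) a
      = -(h x.2.2 ^ 2 * (complexHyperbolic m x.1 a.1 a.1 * complexHyperbolic m x.1 b.1 b.1
            - complexHyperbolic m x.1 a.1 b.1 ^ 2 + 3 * (chHermitian x.1 a.1 b.1).im ^ 2)
          + h x.2.2 ^ 2 * deriv h x.2.2 ^ 2
            * (complexHyperbolic m x.1 a.1 a.1 * complexHyperbolic m x.1 b.1 b.1
              - complexHyperbolic m x.1 a.1 b.1 ^ 2)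
          + h x.2.2 * deriv (deriv h) x.2.2 * complexHyperbolic m x.1
            (a.2.2 • b.1 - b.2.2 • a.1) (a.2.2 • b.1 - b.2.2 • a.1)
          + 1 / 4 * (h x.2.2 * deriv h x.2.2 * (v x.2.2 * deriv v x.2.2)) * complexHyperbolic m x.1
            (a.2.1 • b.1 - b.2.1 • a.1) (a.2.1 • b.1 - b.2.1 • a.1)
          + 1 / 4 * (v x.2.2 * deriv (deriv v) x.2.2) * (a.2.1 * b.2.2 - b.2.1 * a.2.2) ^ 2) := by
  have hh1 := hh0 _ hx.2
  have hv1 := hv0 _ hx.2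
  rw [riemannCurvature_warped hh hv hh0 hv0 hx]
  have hC := complexHyperbolic_curvature (z := x.1) a.1 b.1
  rw [← sub_eq_zero] at hC ⊢
  simp only [warped_apply, warpedChristoffel, warpedChristoffelDeriv, covering,
    chChristoffel_add_right, chChristoffel_smul_right, map_add, map_sub, map_smul, add_apply, sub_apply, smul_apply, smul_eq_mul,
    complexHyperbolic_symm x.1 b.1 a.1] at hC ⊢
  simp only [chChristoffel_symm x.1 b.1 a.1, complexHyperbolic_symm x.1 (chChristoffel _ _ _)]
    at hC ⊢
  rw [← mul_zero (h x.2.2 ^ 2), ← hC]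
  field_simp
  ring

end WarpedCurvature

/-! ### Pinching of the warped product -/

section Pinching

variable {m : ℕ} {v : ℝ → ℝ} {r₀ : ℝ}

lemma gram_warped (h v : ℝ → ℝ) (p : Point m) (a b : Tangent m) :
    warped m h v p a a * warped m h v p b b - warped m h v p a b ^ 2
      = h p.2.2 ^ 4 * (complexHyperbolic m p.1 a.1 a.1 * complexHyperbolic m p.1 b.1 b.1
            - complexHyperbolic m p.1 a.1 b.1 ^ 2)
          + h p.2.2 ^ 2 * complexHyperbolic m p.1
            (a.2.2 • b.1 - b.2.2 • a.1) (a.2.2 • b.1 - b.2.2 • a.1)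
          + 1 / 4 * (h p.2.2 ^ 2 * v p.2.2 ^ 2) * complexHyperbolic m p.1
            (a.2.1 • b.1 - b.2.1 • a.1) (a.2.1 • b.1 - b.2.1 • a.1)
          + 1 / 4 * v p.2.2 ^ 2 * (a.2.1 * b.2.2 - b.2.1 * a.2.2) ^ 2 := by
  simp only [warped_apply, map_sub, map_smul, sub_apply, smul_apply, smul_eq_mul,
    complexHyperbolic_symm p.1 b.1 a.1]
  ring

/-- Every sectional curvature of `cosh² 𝔠_m + ¼ v² dθ² + dr²` is a weighted mean of the four kinds
in `warped_riemannCurvature_apply`, so that bounds on `sinh v' / (cosh v)` and `v'' / v` suffice. -/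
lemma sectionalCurvature_warped_bounds (hv : ContDiff ℝ ∞ v) (hv0 : ∀ r, r₀ ≤ r → 0 < v r)
    {M : ℝ} (hM : 4 ≤ M) {x : Tangent m} (hx : x ∈ tubeCover m r₀)
    (hl₁ : Real.cosh x.2.2 * v x.2.2 ≤ Real.sinh x.2.2 * deriv v x.2.2)
    (hu₁ : Real.sinh x.2.2 * deriv v x.2.2 ≤ M * (Real.cosh x.2.2 * v x.2.2))
    (hl₂ : v x.2.2 ≤ deriv (deriv v) x.2.2) (hu₂ : deriv (deriv v) x.2.2 ≤ M * v x.2.2)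
    {a b : Tangent m} (hab : LinearIndependent ℝ ![a, b]) :
    -M ≤ sectionalCurvature (tubeCover m r₀)
        (fun y => warped m Real.cosh v (covering m y)) x a b ∧
      sectionalCurvature (tubeCover m r₀)
        (fun y => warped m Real.cosh v (covering m y)) x a b ≤ -1 := by
  have hc := Real.cosh_pos x.2.2
  have hv1 := hv0 _ hx.2
  have hpos : 0 < warped m Real.cosh v (covering m x) a a * warped m Real.cosh v (covering m x) b b
      - warped m Real.cosh v (covering m x) a b ^ 2 :=
    gram_pos _ (fun u hu => warped_pos (p := covering m x) hx.1 hc.ne' hv1.ne' hu)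
      (warped_symm _ _ _) hab
  rw [sectionalCurvature, le_div_iff₀ hpos, div_le_iff₀ hpos, gram_warped,
    warped_riemannCurvature_apply Real.contDiff_cosh hv (fun r _ => (Real.cosh_pos r).ne')
      (fun r hr => (hv0 r hr).ne') hx]
  simp only [covering, Real.deriv_cosh, Real.deriv_sinh]
  have hP0 := chHermitian_sq_le hx.1 a.1 b.1
  rw [← complexHyperbolic_eq_re] at hP0
  have hQ := complexHyperbolic_self_nonneg hx.1 (a.2.2 • b.1 - b.2.2 • a.1)
  have hT := complexHyperbolic_self_nonneg hx.1 (a.2.1 • b.1 - b.2.1 • a.1)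
  have hW := sq_nonneg (a.2.1 * b.2.2 - b.2.1 * a.2.2)
  have hI := sq_nonneg (chHermitian x.1 a.1 b.1).im
  have hcs := Real.cosh_sq x.2.2
  generalize complexHyperbolic m x.1 (a.2.2 • b.1 - b.2.2 • a.1) (a.2.2 • b.1 - b.2.2 • a.1) = Q
    at *
  generalize complexHyperbolic m x.1 (a.2.1 • b.1 - b.2.1 • a.1) (a.2.1 • b.1 - b.2.1 • a.1) = T
    at *
  generalize (a.2.1 * b.2.2 - b.2.1 * a.2.2) ^ 2 = W at *
  generalize (chHermitian x.1 a.1 b.1).im ^ 2 = I at *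
  generalize hPe : complexHyperbolic m x.1 a.1 a.1 * complexHyperbolic m x.1 b.1 b.1
    - complexHyperbolic m x.1 a.1 b.1 ^ 2 = P at *
  have hP : I ≤ P := by linarith
  generalize deriv (deriv v) x.2.2 = v₂ at *
  generalize deriv v x.2.2 = v₁ at *
  generalize v x.2.2 = v₀ at *
  generalize Real.cosh x.2.2 = c at *
  generalize Real.sinh x.2.2 = s at *
  have hT₁ : 0 ≤ c * v₀ * T * (s * v₁ - c * v₀) := mul_nonneg (by positivity) (by linarith)
  have hT₂ : 0 ≤ c * v₀ * T * (M * (c * v₀) - s * v₁) := mul_nonneg (by positivity) (by linarith)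
  have hW₁ : 0 ≤ v₀ * W * (v₂ - v₀) := mul_nonneg (by positivity) (by linarith)
  have hW₂ : 0 ≤ v₀ * W * (M * v₀ - v₂) := mul_nonneg (by positivity) (by linarith)
  have hc4 : c ^ 4 = c ^ 2 + c ^ 2 * s ^ 2 := by
    rw [show c ^ 4 = c ^ 2 * c ^ 2 by ring]; nth_rewrite 2 [hcs]; ring
  have hP1 : 0 ≤ P := hI.trans hP
  have hs4 : 0 ≤ c ^ 2 * s ^ 2 * P := by positivity
  have hQ₁ : 0 ≤ c ^ 2 * Q := by positivity
  have hI₁ : 0 ≤ c ^ 2 * I := by positivity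
  have hI₂ : 0 ≤ c ^ 2 * (P - I) := mul_nonneg (by positivity) (by linarith)
  have hM₁ : 0 ≤ (M - 4) * (c ^ 2 * P) := mul_nonneg (by linarith) (by positivity)
  have hM₂ : 0 ≤ (M - 4) * (c ^ 2 * s ^ 2 * P) := mul_nonneg (by linarith) (by positivity)
  have hM₃ : 0 ≤ (M - 4) * (c ^ 2 * Q) := mul_nonneg (by linarith) (by positivity)
  rw [hc4]
  constructor <;> linarith

end Pinching

/-! ### A slowly varying monotone transition -/

section Transition

lemma deriv_smoothTransition_eq_zero {x : ℝ} (hx : x ∉ Set.Icc (0 : ℝ) 1) :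
    deriv Real.smoothTransition x = 0 := by
  rw [Set.mem_Icc, not_and_or, not_le, not_le] at hx
  rcases hx with hx | hx
  · have : Real.smoothTransition =ᶠ[𝓝 x] fun _ => 0 := by
      filter_upwards [gt_mem_nhds hx] with y hy using Real.smoothTransition.zero_of_nonpos hy.le
    rw [this.deriv_eq, deriv_const]
  · have : Real.smoothTransition =ᶠ[𝓝 x] fun _ => 1 := by
      filter_upwards [lt_mem_nhds hx] with y hy using Real.smoothTransition.one_of_one_le hy.le
    rw [this.deriv_eq, deriv_const]

lemma exists_bound_deriv_smoothTransition : ∃ B : ℝ, 0 ≤ B ∧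
    (∀ x, |deriv Real.smoothTransition x| ≤ B) ∧
    ∀ x, |deriv (deriv Real.smoothTransition) x| ≤ B := by
  have h0 : ContDiff ℝ ∞ Real.smoothTransition := Real.smoothTransition.contDiff
  have h1 := (contDiff_infty_iff_deriv.1 h0).2
  have h2 := (contDiff_infty_iff_deriv.1 h1).2
  have hs : HasCompactSupport (deriv Real.smoothTransition) :=
    HasCompactSupport.intro isCompact_Icc fun x hx => deriv_smoothTransition_eq_zero hx
  obtain ⟨B₁, hB₁⟩ := h1.continuous.bounded_above_of_compact_support hs
  obtain ⟨B₂, hB₂⟩ := h2.continuous.bounded_above_of_compact_support hs.deriv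
  exact ⟨max B₁ B₂, (norm_nonneg _).trans ((hB₁ 0).trans (le_max_left _ _)),
    fun x => (hB₁ x).trans (le_max_left _ _), fun x => (hB₂ x).trans (le_max_right _ _)⟩

/-- A transition from `1` to `D` may be spread over an interval so long that its first two
derivatives are as small as desired. -/
lemma exists_slow_transition {D δ : ℝ} (hD : 1 ≤ D) (hδ : 0 < δ) : ∃ (r₃ : ℝ) (σ : ℝ → ℝ),
    1 < r₃ ∧ ContDiff ℝ ∞ σ ∧ Monotone σ ∧ (∀ r ≤ 1, σ r = 1) ∧ (∀ r, r₃ ≤ r → σ r = D) ∧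
    (∀ r, deriv σ r ≤ δ) ∧ ∀ r, |deriv (deriv σ) r| ≤ δ := by
  obtain ⟨B, hB, hB₁, hB₂⟩ := exists_bound_deriv_smoothTransition
  set L : ℝ := 1 + (D - 1) * B / δ with hL
  have hk : 0 ≤ D - 1 := by linarith
  have hL1 : 1 ≤ L := by
    have : 0 ≤ (D - 1) * B / δ := by positivity
    linarith
  have hL0 : 0 < L := by linarith
  have hLB : (D - 1) * B ≤ δ * L := by
    rw [hL, mul_add, mul_div_cancel₀ _ hδ.ne']; linarith
  have h0 : ContDiff ℝ ∞ Real.smoothTransition := Real.smoothTransition.contDiff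
  have h1 := (contDiff_infty_iff_deriv.1 h0).2
  have hlin : ∀ r, HasDerivAt (fun r : ℝ => (r - 1) / L) (1 / L) r := fun r =>
    ((hasDerivAt_id r).sub_const 1).div_const L
  have d1 : deriv (fun r => 1 + (D - 1) * Real.smoothTransition ((r - 1) / L))
      = fun r => (D - 1) * (deriv Real.smoothTransition ((r - 1) / L) * (1 / L)) := by
    funext r
    exact ((((h0.differentiable (by simp) _).hasDerivAt.comp r (hlin r)).const_mul
      (D - 1)).const_add 1).deriv
  have d2 : deriv (deriv (fun r => 1 + (D - 1) * Real.smoothTransition ((r - 1) / L)))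
      = fun r => (D - 1) * (deriv (deriv Real.smoothTransition) ((r - 1) / L) * (1 / L)
        * (1 / L)) := by
    funext r
    rw [d1]
    exact ((((h1.differentiable (by simp) _).hasDerivAt.comp r (hlin r)).mul_const
      (1 / L)).const_mul (D - 1)).deriv
  refine ⟨1 + L, fun r => 1 + (D - 1) * Real.smoothTransition ((r - 1) / L), by linarith,
    by fun_prop (disch := exact hL0.ne'), ?_, ?_, ?_, ?_, ?_⟩
  · intro r s hrs
    have : Real.smoothTransition ((r - 1) / L) ≤ Real.smoothTransition ((s - 1) / L) :=
      Real.smoothTransition.monotone (by gcongr)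
    dsimp only
    gcongr
  · intro r hr
    dsimp only
    rw [Real.smoothTransition.zero_of_nonpos (div_nonpos_of_nonpos_of_nonneg (by linarith) hL0.le)]
    ring
  · intro r hr
    dsimp only
    rw [Real.smoothTransition.one_of_one_le ((one_le_div hL0).2 (by linarith))]
    ring
  · intro r
    rw [d1]
    dsimp only
    calc _ ≤ (D - 1) * (B * (1 / L)) := by
          gcongr
          exact (le_abs_self _).trans (hB₁ _)
      _ ≤ δ := by
          rw [mul_one_div, ← mul_div_assoc]
          exact (div_le_iff₀ hL0).2 hLB
  · intro r
    rw [d2, abs_mul, abs_mul, abs_mul, abs_of_nonneg hk, abs_of_pos (one_div_pos.2 hL0)]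
    calc _ ≤ (D - 1) * (B * (1 / L) * 1) := by
          gcongr
          · exact hB₂ _
          · exact (div_le_one hL0).2 hL1
      _ ≤ δ := by
          rw [mul_one, mul_one_div, ← mul_div_assoc]
          exact (div_le_iff₀ hL0).2 hLB

lemma cosh_two_mul_le {r : ℝ} (hr : 1 ≤ r) : Real.cosh (2 * r) ≤ 2 * Real.sinh (2 * r) := by
  have h1 := Real.add_one_le_exp (2 * r)
  have h2 : Real.exp (-(2 * r)) ≤ 1 := Real.exp_le_one_iff.2 (by linarith)
  rw [Real.cosh_eq, Real.sinh_eq]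
  linarith

end Transition

end WarpedCH

end

theorem theorem3p5 (n : ℕ) (hn : 1 ≤ n) (d : ℕ) (hd : 2 ≤ d) (ε : ℝ) (hε : 0 < ε) :
    ∃ r₂ r₃ : ℝ, 0 < r₂ ∧ r₂ < r₃ ∧ ∃ g : WarpedCH.RiemMetric (n - 1) r₂,
      (∀ p ∈ WarpedCH.tube (n - 1) r₂, p.2.2 = r₂ → g.form p = WarpedCH.gI (n - 1) p) ∧
      (∀ p ∈ WarpedCH.tube (n - 1) r₂, r₃ < p.2.2 → g.form p = WarpedCH.gFold (n - 1) d p) ∧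
      (∀ x ∈ WarpedCH.tubeCover (n - 1) r₂, ∀ u v : WarpedCH.Tangent (n - 1),
        LinearIndependent ℝ ![u, v] →
          -4 - ε < g.sectional x u v ∧ g.sectional x u v < -1 + ε) ∧
      (∃ σ : ℝ → ℝ, ContDiff ℝ ∞ σ ∧ Monotone σ ∧ (∀ r ≤ r₂, σ r = 1) ∧
        (∀ r, r₃ ≤ r → σ r = d) ∧
        ∀ p ∈ WarpedCH.tube (n - 1) r₂, g.form p =
          WarpedCH.warped (n - 1) Real.cosh (fun r => σ r * Real.sinh (2 * r)) p) := by
  -- `9 δ < ε` gives the lower curvature bound; `δ ≤ 1 / 3` keeps `v'' ≥ (4 - δ) v ≥ v`.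
  set δ : ℝ := min (ε / 10) (1 / 3) with hδ
  have hδ0 : 0 < δ := lt_min (by linarith) (by norm_num)
  have hδ1 : δ ≤ ε / 10 := min_le_left _ _
  have hδ2 : δ ≤ 1 / 3 := min_le_right _ _
  have hd1 : (1 : ℝ) ≤ d := by exact_mod_cast (by lia : 1 ≤ d)
  obtain ⟨r₃, σ, hr₃, hσ, hmono, hσ1, hσd, hσ', hσ''⟩ := WarpedCH.exists_slow_transition hd1 hδ0
  have hσ_ge : ∀ r, 1 ≤ σ r := fun r => by
    rcases le_total r 1 with h | h
    · exact (hσ1 r h).ge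
    · exact (hσ1 1 le_rfl).ge.trans (hmono h)
  set v : ℝ → ℝ := fun r => σ r * Real.sinh (2 * r) with hv
  have hvs : ContDiff ℝ ∞ v := by
    have : ContDiff ℝ ∞ (fun r : ℝ => Real.sinh (2 * r)) :=
      Real.contDiff_sinh.comp (contDiff_const.mul contDiff_id)
    exact hσ.mul this
  have hv0 : ∀ r, 1 ≤ r → 0 < v r := fun r hr =>
    mul_pos (by linarith [hσ_ge r]) (Real.sinh_pos_iff.2 (by linarith))
  have hsinh : ∀ r : ℝ, HasDerivAt (fun r => Real.sinh (2 * r)) (2 * Real.cosh (2 * r)) r :=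
    fun r => by simpa [mul_comm] using ((hasDerivAt_id r).const_mul 2).sinh
  have hcosh : ∀ r : ℝ, HasDerivAt (fun r => Real.cosh (2 * r)) (2 * Real.sinh (2 * r)) r :=
    fun r => by simpa [mul_comm] using ((hasDerivAt_id r).const_mul 2).cosh
  have hdσ : ∀ r, HasDerivAt σ (deriv σ r) r := fun r =>
    (hσ.differentiable (by simp) r).hasDerivAt
  have hdσ' : ∀ r, HasDerivAt (deriv σ) (deriv (deriv σ) r) r := fun r =>
    ((contDiff_infty_iff_deriv.1 hσ).2.differentiable (by simp) r).hasDerivAt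
  have hv1 : deriv v = fun r => deriv σ r * Real.sinh (2 * r) + σ r * (2 * Real.cosh (2 * r)) :=
    funext fun r => ((hdσ r).mul (hsinh r)).deriv
  have hv2 : ∀ r, deriv (deriv v) r = deriv (deriv σ) r * Real.sinh (2 * r)
      + 4 * deriv σ r * Real.cosh (2 * r) + 4 * v r := fun r => by
    rw [hv1]
    refine (((hdσ' r).mul (hsinh r)).add
      ((hdσ r).mul ((hcosh r).const_mul 2))).deriv.trans ?_
    rw [hv]
    ring
  refine ⟨1, r₃, one_pos, hr₃, ⟨WarpedCH.warped (n - 1) Real.cosh v,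
    fun p _ => WarpedCH.warped_symm _ _ p,
    fun p hp u hu => WarpedCH.warped_pos hp.1 (Real.cosh_pos _).ne' (hv0 _ hp.2).ne' hu,
    (WarpedCH.contDiffOn_warped Real.contDiff_cosh hvs).mono fun x hx => hx.1⟩, ?_, ?_, ?_,
    σ, hσ, hmono, hσ1, hσd, fun p _ => rfl⟩
  · intro p hp hr
    simp [WarpedCH.gI, WarpedCH.warped, hv, hr, hσ1 1 le_rfl]
  · intro p hp hr
    simp [WarpedCH.gFold, WarpedCH.warped, hv, hσd _ hr.le]
  · intro x hx a b hab
    have hr : 1 ≤ x.2.2 := hx.2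
    have hσ0 := hσ_ge x.2.2
    have hs0 : 0 < Real.sinh x.2.2 := Real.sinh_pos_iff.2 (by linarith)
    have hsc : Real.sinh x.2.2 < Real.cosh x.2.2 := Real.sinh_lt_cosh _
    have hS : 0 < Real.sinh (2 * x.2.2) := Real.sinh_pos_iff.2 (by linarith)
    have hC := WarpedCH.cosh_two_mul_le hr
    have hσp : 0 ≤ deriv σ x.2.2 := hmono.deriv_nonneg
    have hσp' := hσ' x.2.2
    have hvS : Real.sinh (2 * x.2.2) ≤ v x.2.2 := le_mul_of_one_le_left hS.le hσ0
    have hC0 := Real.cosh_pos (2 * x.2.2)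
    -- Both bounds on `v''` follow from `|v'' - 4 v| ≤ δ (sinh 2r + 4 cosh 2r) ≤ 9 δ v`.
    have e1 : |deriv (deriv σ) x.2.2 * Real.sinh (2 * x.2.2)| ≤ δ * v x.2.2 := by
      rw [abs_mul, abs_of_pos hS]
      exact mul_le_mul (hσ'' _) hvS hS.le hδ0.le
    have e2 : deriv σ x.2.2 * Real.cosh (2 * x.2.2) ≤ δ * (2 * v x.2.2) :=
      mul_le_mul hσp' (by linarith) hC0.le hδ0.le
    have e3 : 0 ≤ deriv σ x.2.2 * Real.cosh (2 * x.2.2) := by positivity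
    have e4 : δ * v x.2.2 ≤ 1 / 3 * v x.2.2 := mul_le_mul_of_nonneg_right hδ2 (hv0 _ hr).le
    have e5 := abs_le.1 e1
    have hsv : Real.sinh x.2.2 * deriv v x.2.2
        = 2 * deriv σ x.2.2 * Real.sinh x.2.2 ^ 2 * Real.cosh x.2.2
          + 2 * σ x.2.2 * Real.sinh x.2.2 * (Real.cosh x.2.2 ^ 2 + Real.sinh x.2.2 ^ 2) := by
      rw [hv1]; simp only [Real.sinh_two_mul, Real.cosh_two_mul]; ring
    have hcv : Real.cosh x.2.2 * v x.2.2
        = 2 * σ x.2.2 * Real.sinh x.2.2 * Real.cosh x.2.2 ^ 2 := by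
      rw [hv]; simp only [Real.sinh_two_mul]; ring
    have hc0 : 0 < Real.cosh x.2.2 := Real.cosh_pos _
    have f1 : 0 ≤ deriv σ x.2.2 * Real.sinh x.2.2 ^ 2 * Real.cosh x.2.2 := by positivity
    have f2 : 0 ≤ σ x.2.2 * Real.sinh x.2.2 * Real.sinh x.2.2 ^ 2 := by positivity
    have f3 : σ x.2.2 * Real.sinh x.2.2 * Real.sinh x.2.2 ^ 2
        ≤ σ x.2.2 * Real.sinh x.2.2 * Real.cosh x.2.2 ^ 2 := by gcongr
    have f4 : deriv σ x.2.2 * Real.sinh x.2.2 ^ 2 * Real.cosh x.2.2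
        ≤ σ x.2.2 * Real.sinh x.2.2 * Real.cosh x.2.2 ^ 2 := by
      calc _ = deriv σ x.2.2 * (Real.sinh x.2.2 * (Real.sinh x.2.2 * Real.cosh x.2.2)) := by ring
        _ ≤ σ x.2.2 * (Real.sinh x.2.2 * (Real.cosh x.2.2 * Real.cosh x.2.2)) := by
          gcongr
          linarith
        _ = _ := by ring
    have f5 : 0 ≤ δ * (Real.cosh x.2.2 * v x.2.2) := by
      have := hv0 _ hr
      positivity
    have hsec := WarpedCH.sectionalCurvature_warped_bounds (m := n - 1) (r₀ := 1) (M := 4 + 9 * δ)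
      hvs hv0 (by linarith) hx (by rw [hsv, hcv]; linarith)
      (by rw [hcv] at f5; rw [hsv, hcv]; linarith)
      (by rw [hv2]; linarith) (by rw [hv2]; linarith) hab
    change _ < WarpedCH.sectionalCurvature _ _ x a b ∧ WarpedCH.sectionalCurvature _ _ x a b < _
    exact ⟨lt_of_lt_of_le (by linarith) hsec.1, lt_of_le_of_lt hsec.2 (by linarith)⟩
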